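/- **Setting.** Let $d\in\{2,3\}$ and $k\ge 0$. Let $\Omega\subset\mathbb R^d$ be a bounded, connected, nonempty open set with $\Omega=\operatorname{int}\overline\Omega$ (for instance a polygonal or polyhedral domain with Lipschitz boundary), and let $\mathcal T_h$ be a conforming triangulation of $\overline\Omega$ into finitely many nondegenerate closed $d$-simplices $K$, with $\mathcal E_h$ the set of all $(d-1)$-dimensional faces $E$ of these simplices and $h_K=\operatorname{diam}K$. For $\sigma>0$, the triangulation is called shape-regular with constant $\sigma$ if every $K\in\mathcal T_h$ contains a ball of some diameter $\rho$ with $h_K\le\sigma\rho$. Put $$(w,v)_{\mathcal T_h}=\sum_{K}\int_K wv,\qquad \langle\zeta,\rho\rangle_{\partial\mathcal T_h}=\sum_K\int_{\partial K}\zeta\rho,$$ and let $\boldsymbol V_h$, $W_h$, $M_h$ be the spaces of, respectively, vector fields that are in $[\mathcal P^k(K)]^d$ on each $K$, scalar functions that are in $\mathcal P^{k+1}(K)$ on each $K$, and functions on the faces that are in $\mathcal P^k(E)$ on each $E\in\mathcal E_h$ (no continuity is required). Let $\Pi_k^\partial$ be the $L^2(E)$-orthogonal projection onto $\mathcal P^k(E)$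 on each face $E$ of each $K$, let $\boldsymbol n$ be the outward unit normal on $\partial K$, let differential operators act elementwise, and let $$\begin{aligned}\mathcal A(\boldsymbol q,u,\widehat u;\boldsymbol r,w,\mu)={}&(\boldsymbol q,\boldsymbol r)_{\mathcal T_h}-(u,\nabla\cdot\boldsymbol r)_{\mathcal T_h}+\langle\widehat u,\boldsymbol r\cdot\boldsymbol n\rangle_{\partial\mathcal T_h}+(\nabla\cdot\boldsymbol q,w)_{\mathcal T_h}-\langle\boldsymbol q\cdot\boldsymbol n,\mu\rangle_{\partial\mathcal T_h}\\&+\langle h_K^{-1}(\Pi_k^\partial u-\widehat u),\Pi_k^\partial w-\mu\rangle_{\partial\mathcal T_h}.\end{aligned}$$ **The scheme.** Let $\epsilon>0$, $\Delta t>0$. One time step of the HDG scheme is: given $u_h^{n-1}\in W_h$, find $(\boldsymbol p_h^n,\phi_h^n,\widehat\phi_h^n),(\boldsymbol q_h^n,u_h^n,\widehat u_h^n)\in\boldsymbol V_h\times W_h\times M_h$ such that for all $(\boldsymbol r_1,w_1,\mu_1),(\boldsymbol r_2,w_2,\mu_2)\in\boldsymbol V_h\times W_h\times M_h$ $$\Big(\tfrac{u_h^n-u_h^{n-1}}{\Delta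 t},w_1\Big)_{\mathcal T_h}+\mathcal A(\boldsymbol p_h^n,\phi_h^n,\widehat\phi_h^n;\boldsymbol r_1,w_1,\mu_1)=0,$$ $$(\epsilon^{-1}f^n,w_2)_{\mathcal T_h}+\epsilon\,\mathcal A(\boldsymbol q_h^n,u_h^n,\widehat u_h^n;\boldsymbol r_2,w_2,\mu_2)-(\phi_h^n,w_2)_{\mathcal T_h}=0.$$ Here $f^n=(u_h^n)^3-u_h^{n-1}$ for the convex-splitting method and $f^n=(u_h^n)^3-u_h^n$ for the backward Euler method. The whole scheme consists of these steps for $n=1,\dots,N$, started from $u_h^0\in W_h$ with $(u_h^0,w)_{\mathcal T_h}=(u^0,w)_{\mathcal T_h}$ for all $w\in W_h$. Call the scheme *uniquely solvable* if each single step has exactly one solution for every $u_h^{n-1}\in W_h$, and the whole scheme has exactly one solution for every $N$ and every $u^0\in L^2(\Omega)$. **Theorem.** 1. The convex-splitting scheme is uniquely solvable for every such $\Omega$ and $\mathcal T_h$ and for all $\epsilon>0$, $\Delta t>0$. 2. For every $\sigma>0$ there is a constant $C>0$, depending only on $d$, $k$ and $\sigma$, such that the backward Euler scheme is uniquely solvable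 for every such $\Omega$, every such $\mathcal T_h$ that is shape-regular with constant $\sigma$, and all $\epsilon>0$, $\Delta t>0$ with $\Delta t\le C\epsilon^3$. -/

import Mathlib

open MeasureTheory

noncomputable section

namespace CahnHilliardHDG

/-- A conforming triangulation of a domain `Ω ⊆ ℝᵈ`: a finite geometric simplicial complex, all of
whose simplices are faces of `d`-simplices, which covers the closure of `Ω`. -/
structure Triangulation {d : ℕ} (Ω : Set (EuclideanSpace ℝ (Fin d))) where
  /-- the underlying simplicial complex; simplices are given by their vertex sets -/
  cplx : Geometry.SimplicialComplex ℝ (EuclideanSpace ℝ (Fin d))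
  finite_faces : cplx.faces.Finite
  pure_dim : ∀ s ∈ cplx.faces, ∃ t ∈ cplx.faces, s ⊆ t ∧ t.card = d + 1
  space_eq : cplx.space = closure Ω

/-- The value of a polynomial at a point of `ℝᵈ`. -/
def evalAt {d : ℕ} (p : MvPolynomial (Fin d) ℝ) (x : EuclideanSpace ℝ (Fin d)) : ℝ :=
  MvPolynomial.eval (fun i => x i) p

theorem continuous_evalAt {d : ℕ} (p : MvPolynomial (Fin d) ℝ) : Continuous (evalAt p) :=
  (MvPolynomial.continuous_eval p).comp (by fun_prop)

/-- An `n`-simplex has finite `n`-dimensional volume. -/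
theorem volume_simplex_lt_top {d n : ℕ} (t : Finset (EuclideanSpace ℝ (Fin d)))
    (ht : AffineIndependent ℝ ((↑) : t → EuclideanSpace ℝ (Fin d))) (hc : t.card = n + 1) :
    Measure.euclideanHausdorffMeasure n
      (convexHull ℝ (t : Set (EuclideanSpace ℝ (Fin d)))) < ⊤ := by
  have hne : t.Nonempty := Finset.card_pos.mp (by omega)
  obtain ⟨x, hx⟩ := hne
  set V := vectorSpan ℝ (t : Set (EuclideanSpace ℝ (Fin d))) with hV
  have hfin : Module.finrank ℝ V = n := by
    have h := ht.finrank_vectorSpan (n := n) (by simpa using hc)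
    have hr : Set.range ((↑) : t → EuclideanSpace ℝ (Fin d)) = (t : Set _) := by
      ext y
      simp
    rwa [hr] at h
  let f : V → EuclideanSpace ℝ (Fin d) := fun y => (y : EuclideanSpace ℝ (Fin d)) + x
  have hf : Isometry f := (isometry_add_right x).comp isometry_subtype_coe
  have hcpt : IsCompact (convexHull ℝ (t : Set (EuclideanSpace ℝ (Fin d)))) :=
    t.finite_toSet.isCompact_convexHull ℝ
  have hcl : Topology.IsClosedEmbedding f :=
    hf.isClosedEmbedding
  have hsub : convexHull ℝ (t : Set (EuclideanSpace ℝ (Fin d))) ⊆ Set.range f := by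
    intro z hz
    have hz' := convexHull_subset_affineSpan (t : Set (EuclideanSpace ℝ (Fin d))) hz
    have hd := AffineSubspace.vsub_mem_direction hz'
      (subset_affineSpan ℝ (t : Set (EuclideanSpace ℝ (Fin d))) hx)
    rw [direction_affineSpan] at hd
    exact ⟨⟨z -ᵥ x, hd⟩, by simp [f]⟩
  rw [← Set.image_preimage_eq_of_subset hsub, hf.euclideanHausdorffMeasure_image, ← hfin]
  exact (hcl.isCompact_preimage hcpt).measure_lt_top

namespace Triangulation

variable {d : ℕ} {Ω : Set (EuclideanSpace ℝ (Fin d))} (T : Triangulation Ω)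

/-- The elements `K` of the triangulation: its `d`-simplices. -/
def Elem : Type := {s : Finset (EuclideanSpace ℝ (Fin d)) // s ∈ T.cplx.faces ∧ s.card = d + 1}

/-- The faces `E` of the triangulation: the `(d-1)`-dimensional faces of its `d`-simplices. -/
def Face : Type := {t : Finset (EuclideanSpace ℝ (Fin d)) // t ∈ T.cplx.faces ∧ t.card = d}

instance : Fintype T.Elem :=
  (T.finite_faces.subset (fun _ hs => hs.1) :
    {s : Finset (EuclideanSpace ℝ (Fin d)) | s ∈ T.cplx.faces ∧ s.card = d + 1}.Finite).fintype

instance : Fintype T.Face :=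
  (T.finite_faces.subset (fun _ hs => hs.1) :
    {s : Finset (EuclideanSpace ℝ (Fin d)) | s ∈ T.cplx.faces ∧ s.card = d}.Finite).fintype

variable {T}

/-- The closed simplex spanned by the vertices of `K`. -/
def Elem.carrier (K : T.Elem) : Set (EuclideanSpace ℝ (Fin d)) :=
  convexHull ℝ (K.1 : Set (EuclideanSpace ℝ (Fin d)))

/-- The closed simplex spanned by the vertices of the face `E`. -/
def Face.carrier (E : T.Face) : Set (EuclideanSpace ℝ (Fin d)) :=
  convexHull ℝ (E.1 : Set (EuclideanSpace ℝ (Fin d)))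

/-- The diameter `h_K`. -/
def Elem.diam (K : T.Elem) : ℝ := Metric.diam K.carrier

open Classical in
/-- The faces `E ⊆ ∂K`. -/
def Elem.bdry (K : T.Elem) : Finset T.Face := Finset.univ.filter fun E => E.1 ⊆ K.1

/-- The component, orthogonal to the face `E`, of the vector from the barycentre of `K` to the
barycentre of `E`. -/
def normalDir (K : T.Elem) (E : T.Face) : EuclideanSpace ℝ (Fin d) :=
  (vectorSpan ℝ (E.1 : Set (EuclideanSpace ℝ (Fin d))))ᗮ.starProjection
    (E.1.centroid ℝ id - K.1.centroid ℝ id)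

/-- The unit outward normal `n` of `K` on its face `E ⊆ ∂K`. -/
def normal (K : T.Elem) (E : T.Face) : EuclideanSpace ℝ (Fin d) :=
  ‖normalDir K E‖⁻¹ • normalDir K E

/-- Surface measure on the face `E` (the `(d-1)`-dimensional Hausdorff measure, normalised so as to
agree with Lebesgue measure on hyperplanes). -/
def Face.surf (E : T.Face) : Measure (EuclideanSpace ℝ (Fin d)) :=
  (Measure.euclideanHausdorffMeasure (d - 1)).restrict E.carrier

/-- `L²(E)`. -/
abbrev L2 (E : T.Face) : Type := Lp ℝ 2 E.surf

theorem memLp_evalAt (E : T.Face) (p : MvPolynomial (Fin d) ℝ) : MemLp (evalAt p) 2 E.surf := by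
  have hd : E.1.card = (d - 1) + 1 := by
    have h1 := E.2.2
    have h2 : E.1.Nonempty := T.cplx.nonempty_of_mem_faces E.2.1
    have h3 := h2.card_pos
    omega
  have hfin : IsFiniteMeasure E.surf :=
    ⟨by simpa [Face.surf, Face.carrier] using
      volume_simplex_lt_top E.1 (T.cplx.indep E.2.1) hd⟩
  have hcpt : IsCompact E.carrier := E.1.finite_toSet.isCompact_convexHull ℝ
  obtain ⟨C, hC⟩ := hcpt.exists_bound_of_continuousOn (continuous_evalAt p).continuousOn
  refine MemLp.of_bound (continuous_evalAt p).aestronglyMeasurable C ?_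
  exact (ae_restrict_mem hcpt.measurableSet).mono hC

/-- The restriction (trace) of a polynomial to the face `E`, as an element of `L²(E)`. -/
def trace (E : T.Face) : MvPolynomial (Fin d) ℝ →ₗ[ℝ] L2 E where
  toFun p := (memLp_evalAt E p).toLp (evalAt p)
  map_add' p q := by
    rw [← MemLp.toLp_add]
    congr 1
    ext x
    simp [evalAt]
  map_smul' c p := by
    rw [RingHom.id_apply, ← MemLp.toLp_const_smul]
    congr 1
    ext x
    simp [evalAt]

/-- `𝒫ᵐ(E) ⊆ L²(E)`: the polynomials of degree at most `m` on the face `E`. -/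
def facePoly (m : ℕ) (E : T.Face) : Submodule ℝ (L2 E) :=
  (MvPolynomial.restrictTotalDegree (Fin d) ℝ m).map (trace E)

instance (m : ℕ) (E : T.Face) : FiniteDimensional ℝ (facePoly m E) := by
  unfold facePoly
  infer_instance

variable (T)

/-- `W_h` (with `m = k + 1`): scalar functions which on each element `K` are polynomials of degree
at most `m`. A polynomial is determined by its restriction to `K`, as `K` has nonempty interior. -/
abbrev BrokenPoly (m : ℕ) : Type := T.Elem → MvPolynomial.restrictTotalDegree (Fin d) ℝ m

/-- `V_h`: vector fields with components of degree at most `k` on each element. -/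
abbrev FluxSpace (k : ℕ) : Type :=
  T.Elem → Fin d → MvPolynomial.restrictTotalDegree (Fin d) ℝ k

/-- `M_h`: the functions on the union of all faces (one value on each face) that are polynomials of
degree at most `k` on each face. -/
abbrev TraceSpace (k : ℕ) : Type := (E : T.Face) → facePoly k E

variable {T}

/-- The polynomial representing `w_h` on `K`. -/
def BrokenPoly.on {m : ℕ} (w : T.BrokenPoly m) (K : T.Elem) : MvPolynomial (Fin d) ℝ := (w K).1

/-- The divergence of `r_h` on `K`. -/
def FluxSpace.div {k : ℕ} (r : T.FluxSpace k) (K : T.Elem) : MvPolynomial (Fin d) ℝ :=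
  ∑ i, MvPolynomial.pderiv i (r K i).1

/-- The inner product `(w, v)_{𝒯_h}` of two piecewise polynomials. -/
def inner_T (w v : T.Elem → MvPolynomial (Fin d) ℝ) : ℝ :=
  ∑ K, ∫ x in K.carrier, evalAt (w K) x * evalAt (v K) x

/-- The inner product `(q, r)_{𝒯_h}` of two vector fields in `V_h`. -/
def innerFlux {k : ℕ} (q r : T.FluxSpace k) : ℝ :=
  ∑ K, ∫ x in K.carrier, ∑ i, evalAt (q K i).1 x * evalAt (r K i).1 x

/-- The inner product `⟨ζ, ρ⟩_{∂𝒯_h} = ∑_K ∑_{E ⊆ ∂K} ∫_E ζ ρ`; the functions may take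
different values on a face `E` from its two sides. -/
def inner_bdry (ζ ρ : T.Elem → (E : T.Face) → L2 E) : ℝ :=
  ∑ K, ∑ E ∈ K.bdry, inner ℝ (ζ K E) (ρ K E)

/-- The normal trace `r_h · n` on `E ⊆ ∂K`. -/
def normalTrace {k : ℕ} (r : T.FluxSpace k) (K : T.Elem) (E : T.Face) : L2 E :=
  ∑ i, normal K E i • trace E (r K i).1

/-- `μ_h` as a function on `∂𝒯_h` (the same on both sides of each face). -/
def twoSided {k : ℕ} (μ : T.TraceSpace k) (_K : T.Elem) (E : T.Face) : L2 E := μ E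

/-- `Π_k^∂ w_h - μ_h` on `E ⊆ ∂K`, where `Π_k^∂` is the `L²(E)`-orthogonal projection onto
`𝒫ᵏ(E)`. -/
def stabJump {k m : ℕ} (w : T.BrokenPoly m) (μ : T.TraceSpace k) (K : T.Elem) (E : T.Face) :
    L2 E :=
  (facePoly k E).starProjection (trace E (w.on K)) - twoSided μ K E

/-- The bilinear form `𝒜(q_h, u_h, û_h; r_h, w_h, μ_h)`. -/
def formA {k : ℕ} (q : T.FluxSpace k) (u : T.BrokenPoly (k + 1)) (uhat : T.TraceSpace k)
    (r : T.FluxSpace k) (w : T.BrokenPoly (k + 1)) (μ : T.TraceSpace k) : ℝ :=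
  innerFlux q r - inner_T u.on r.div + inner_bdry (twoSided uhat) (normalTrace r)
    + inner_T q.div w.on - inner_bdry (normalTrace q) (twoSided μ)
    + inner_bdry (fun K E => K.diam⁻¹ • stabJump u uhat K E) (stabJump w μ)

variable (T)

/-- The unknowns `(p_h, φ_h, φ̂_h)` and `(q_h, u_h, û_h)` at one time level. -/
structure Unknowns (k : ℕ) where
  p : T.FluxSpace k
  φ : T.BrokenPoly (k + 1)
  φhat : T.TraceSpace k
  q : T.FluxSpace k
  u : T.BrokenPoly (k + 1)
  uhat : T.TraceSpace k

variable {T}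

/-- One time step of the HDG scheme, from `u_h^{n-1} = uprev` to the unknowns `X` at time level `n`,
with time step `Δt` and nonlinearity `fⁿ(u_h^n) = f (u_h^n, u_h^{n-1})` (taken pointwise). -/
structure IsStep {k : ℕ} (f : ℝ → ℝ → ℝ) (ε Δt : ℝ) (uprev : T.BrokenPoly (k + 1))
    (X : T.Unknowns k) : Prop where
  eq_one : ∀ (r : T.FluxSpace k) (w : T.BrokenPoly (k + 1)) (μ : T.TraceSpace k),
    inner_T (Δt⁻¹ • (X.u - uprev)).on w.on + formA X.p X.φ X.φhat r w μ = 0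
  eq_two : ∀ (r : T.FluxSpace k) (w : T.BrokenPoly (k + 1)) (μ : T.TraceSpace k),
    (∑ K, ∫ x in K.carrier,
        ε⁻¹ * f (evalAt (X.u.on K) x) (evalAt (uprev.on K) x) * evalAt (w.on K) x)
      + ε * formA X.q X.u X.uhat r w μ - inner_T X.φ.on w.on = 0

/-- The fully discrete HDG scheme with `N` time steps of size `Δt` and initial datum `u⁰`. A solution
consists of `u_h^0` and of the unknowns at the time levels `1, …, N`, where `X n` is the time level
`n + 1`. -/
structure IsSolution {k N : ℕ} (f : ℝ → ℝ → ℝ) (ε Δt : ℝ) (u0 : EuclideanSpace ℝ (Fin d) → ℝ)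
    (uh0 : T.BrokenPoly (k + 1)) (X : Fin N → T.Unknowns k) : Prop where
  initial : ∀ w : T.BrokenPoly (k + 1),
    inner_T uh0.on w.on - ∑ K : T.Elem, ∫ x in K.carrier, u0 x * evalAt (w.on K) x = 0
  step : ∀ n : Fin N,
    IsStep f ε Δt (Fin.cons (α := fun _ => T.BrokenPoly (k + 1)) uh0 (fun m => (X m).u) n.castSucc)
      (X n)

/-- Shape regularity with constant `σ`: every element `K` contains a ball of diameter `2 r` with
`h_K ≤ σ (2 r)`. -/
def ShapeRegular (T : Triangulation Ω) (σ : ℝ) : Prop :=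
  ∀ K : T.Elem, ∃ x : EuclideanSpace ℝ (Fin d), ∃ r : ℝ, 0 < r ∧
    Metric.closedBall x r ⊆ K.carrier ∧ K.diam ≤ σ * (2 * r)

end Triangulation

/-- The convex-splitting nonlinearity `fⁿ = (u_h^n)³ - u_h^{n-1}`. -/
def convexSplitting (u uprev : ℝ) : ℝ := u ^ 3 - uprev

/-- The backward Euler (fully implicit) nonlinearity `fⁿ = (u_h^n)³ - u_h^n`. -/
def backwardEuler (u _uprev : ℝ) : ℝ := u ^ 3 - u

/-- The HDG scheme with nonlinearity `f` and parameters `ε`, `Δt` has exactly one solution: at each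
single time step, for every previous `u_h^{n-1} ∈ W_h`, and for the whole scheme, for every number
`N` of steps and every initial datum `u⁰ ∈ L²(Ω)`. -/
def UniquelySolvable {d : ℕ} {Ω : Set (EuclideanSpace ℝ (Fin d))} (T : Triangulation Ω) (k : ℕ)
    (f : ℝ → ℝ → ℝ) (ε Δt : ℝ) : Prop :=
  (∀ uprev : T.BrokenPoly (k + 1), ∃! X : T.Unknowns k, Triangulation.IsStep f ε Δt uprev X) ∧
  (∀ (N : ℕ) (u0 : EuclideanSpace ℝ (Fin d) → ℝ), MemLp u0 2 (volume.restrict Ω) →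
    ∃! Y : T.BrokenPoly (k + 1) × (Fin N → T.Unknowns k),
      Triangulation.IsSolution f ε Δt u0 Y.1 Y.2)

/-- A domain: a connected (in particular nonempty) open set that lies on one side of its boundary
in the sense that it is the interior of its closure, as is every open set with Lipschitz
boundary. -/
structure IsRegularDomain {d : ℕ} (Ω : Set (EuclideanSpace ℝ (Fin d))) : Prop where
  isOpen : IsOpen Ω
  isConnected : IsConnected Ω
  interior_closure : interior (closure Ω) = Ω

end CahnHilliardHDG

end

/-!
The unique solvability of a time step is an algebraic consequence of the structure of `𝒜`.

Write `U = (u, û)`. Then `𝒜(q, U; r, W) = (q, r) - B(r, U) + B(q, W) + s(U, W)` with the coupling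
`B(r, U) = (u, ∇·r) - ⟨û, r·n⟩` and the stabilization `s`, which is positive definite in `û` because
each face lies on the boundary of an element. Static condensation (`exists_condensed`) therefore
eliminates `q` and `û`: there is an operator `L` on `W_h`, symmetric and positive semidefinite for
the `L²` inner product, such that a step of the scheme amounts to
`(u - v) / Δt + L φ = 0` and `φ = ∇Φ(u) + ε L u`, where `v = u_h^{n-1}` and `Φ` is the potential
energy `ε⁻¹ ∫ (u⁴/4 - a u²/2 - b v u)`, with `(a, b) = (0, 1)` for convex splitting and
`(a, b) = (1, 0)` for backward Euler.

A solution exists for all parameters (`exists_reduced_solution`): with `u = v - Δt L z`, it is given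
by a minimizer `z` of `Δt / 2 (L z, z) + Φ(u) + ε / 2 (L u, u)`, which is coercive modulo the kernel
of `L` since `Φ` is bounded below.

For uniqueness (`reduced_solution_unique`), test the equations for the difference `(u, φ)` of two
solutions: `Δt (L φ, φ) + ε (L u, u) ≤ (a / ε) ‖u‖²` by monotonicity of the cube, while
`‖u‖² = -Δt (L φ, u)`. The Cauchy–Schwarz inequality for `L` gives `u = 0` if `(a / ε)² Δt < 4 ε`.
This always holds for `a = 0`, and for `a = 1` it reads `Δt < 4 ε³`, so the constant `C = 1` serves
all meshes.

The whole scheme follows by induction on the number of steps, once the `L²` projection of the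
initial datum is known to be well defined (`existsUnique_initial`).
-/

noncomputable section

namespace CahnHilliardHDG

/-! ### Positive definite forms and static condensation -/

section Condensation

theorem injective_of_forall_pos {V : Type*} [AddCommGroup V] [Module ℝ V]
    (b : LinearMap.BilinForm ℝ V) (hb : ∀ x, x ≠ 0 → 0 < b x x) :
    Function.Injective b := by
  rw [injective_iff_map_eq_zero]
  intro x hx
  by_contra h
  have := hb x h
  simp [hx] at this

variable {V W M : Type*} [AddCommGroup V] [Module ℝ V] [FiniteDimensional ℝ V]
  [AddCommGroup W] [Module ℝ W] [FiniteDimensional ℝ W]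
  [AddCommGroup M] [Module ℝ M] [FiniteDimensional ℝ M]

/-- Lax–Milgram in finite dimension; no symmetry is needed. -/
theorem surjective_of_forall_pos (b : LinearMap.BilinForm ℝ V) (hb : ∀ x, x ≠ 0 → 0 < b x x) :
    Function.Surjective b :=
  (LinearMap.injective_iff_surjective_of_finrank_eq_finrank
    (Subspace.dual_finrank_eq (K := ℝ) (V := V)).symm).1 (injective_of_forall_pos b hb)

/-- Static condensation. In a saddle-type form
`(q, r) - B(r, (u, û)) + B(q, (w, μ)) + s((u, û), (w, μ))`, whose part acting on the pair `(q, û)`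
alone is positive definite, the flux `q` and the trace `û` are linear functions of `u`, and what
remains is a symmetric positive semidefinite operator `L` on the scalar space. -/
theorem exists_condensed (mV : LinearMap.BilinForm ℝ V) (mW : LinearMap.BilinForm ℝ W)
    (B : V →ₗ[ℝ] W × M →ₗ[ℝ] ℝ) (s : LinearMap.BilinForm ℝ (W × M))
    (mV_symm : ∀ q r, mV q r = mV r q) (mV_pos : ∀ q, q ≠ 0 → 0 < mV q q)
    (mW_pos : ∀ u, u ≠ 0 → 0 < mW u u)
    (s_symm : ∀ X Y, s X Y = s Y X) (s_nonneg : ∀ X, 0 ≤ s X X)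
    (s_pos : ∀ μ : M, μ ≠ 0 → 0 < s (0, μ) (0, μ)) :
    ∃ (Q : W →ₗ[ℝ] V) (H : W →ₗ[ℝ] M) (L : W →ₗ[ℝ] W),
      (∀ u w, mW (L u) w = mW (L w) u) ∧ (∀ u, 0 ≤ mW (L u) u) ∧
      ∀ q u û g, (∀ r w μ, mV q r - B r (u, û) + B q (w, μ) + s (u, û) (w, μ) = mW g w) ↔
        q = Q u ∧ û = H u ∧ g = L u := by
  let iM : M →ₗ[ℝ] W × M := LinearMap.inr ℝ W M
  let iW : W →ₗ[ℝ] W × M := LinearMap.inl ℝ W M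
  -- the part of the form acting on the pair `(q, û)`
  let c : LinearMap.BilinForm ℝ (V × M) := LinearMap.mk₂ ℝ
    (fun z y => mV z.1 y.1 - B y.1 (iM z.2) + B z.1 (iM y.2) + s (iM z.2) (iM y.2))
    (by intro x y z; simp only [Prod.fst_add, Prod.snd_add, map_add, LinearMap.add_apply]; ring)
    (by intro a x z
        simp only [Prod.smul_fst, Prod.smul_snd, map_smul, LinearMap.smul_apply, smul_eq_mul]; ring)
    (by intro x y z; simp only [Prod.fst_add, Prod.snd_add, map_add, LinearMap.add_apply]; ring)
    (by intro a x z
        simp only [Prod.smul_fst, Prod.smul_snd, map_smul, LinearMap.smul_apply, smul_eq_mul]; ring)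
  have hc : ∀ z, z ≠ 0 → 0 < c z z := by
    rintro ⟨q, μ⟩ hz
    have h1 : c (q, μ) (q, μ) = mV q q + s (0, μ) (0, μ) := by
      simp [c, iM]
    rw [h1]
    by_cases hq : q = 0
    · have hμ : μ ≠ 0 := fun h => hz (by simp [hq, h])
      simpa [hq] using s_pos μ hμ
    · exact add_pos_of_pos_of_nonneg (mV_pos q hq) (s_nonneg _)
  let ce : (V × M) ≃ₗ[ℝ] Module.Dual ℝ (V × M) :=
    LinearEquiv.ofBijective c ⟨injective_of_forall_pos c hc, surjective_of_forall_pos c hc⟩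
  let me : W ≃ₗ[ℝ] Module.Dual ℝ W :=
    LinearEquiv.ofBijective mW ⟨injective_of_forall_pos mW mW_pos, surjective_of_forall_pos mW mW_pos⟩
  -- the load that `u` exerts on the pair `(q, û)`
  let rhs : W →ₗ[ℝ] Module.Dual ℝ (V × M) := LinearMap.mk₂ ℝ
    (fun u y => B y.1 (iW u) - s (iW u) (iM y.2))
    (by intro x y z; simp only [map_add, LinearMap.add_apply]; ring)
    (by intro a x z; simp only [map_smul, LinearMap.smul_apply, smul_eq_mul]; ring)
    (by intro x y z; simp only [Prod.fst_add, Prod.snd_add, map_add, LinearMap.add_apply]; ring)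
    (by intro a x z
        simp only [Prod.smul_fst, Prod.smul_snd, map_smul, LinearMap.smul_apply, smul_eq_mul]; ring)
  let S : W →ₗ[ℝ] V × M := ce.symm.toLinearMap ∘ₗ rhs
  let Q : W →ₗ[ℝ] V := LinearMap.fst ℝ V M ∘ₗ S
  let H : W →ₗ[ℝ] M := LinearMap.snd ℝ V M ∘ₗ S
  let U : W →ₗ[ℝ] W × M := LinearMap.prod LinearMap.id H
  -- what remains for test functions `w` after eliminating `(q, û)`
  let res : W →ₗ[ℝ] Module.Dual ℝ W := LinearMap.mk₂ ℝ
    (fun u w => B (Q u) (iW w) + s (U u) (iW w))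
    (by intro x y z; simp only [map_add, LinearMap.add_apply]; ring)
    (by intro a x z; simp only [map_smul, LinearMap.smul_apply, smul_eq_mul]; ring)
    (by intro x y z; simp only [map_add]; ring)
    (by intro a x z; simp only [map_smul, smul_eq_mul]; ring)
  let L : W →ₗ[ℝ] W := me.symm.toLinearMap ∘ₗ res
  have hL : ∀ u w, mW (L u) w = B (Q u) (iW w) + s (U u) (iW w) := by
    intro u w
    have : me (L u) = res u := by simp [L]
    exact congrArg (fun l : Module.Dual ℝ W => l w) this
  have hS : ∀ u y, c (Q u, H u) y = B y.1 (iW u) - s (iW u) (iM y.2) := by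
    intro u y
    have : ce (S u) = rhs u := by simp [S]
    exact congrArg (fun l : Module.Dual ℝ (V × M) => l y) this
  have split : ∀ (w : W) (μ : M), (w, μ) = iW w + iM μ := by
    intro w μ; simp [iW, iM]
  have hA : ∀ u r w μ, mV (Q u) r - B r (u, H u) + B (Q u) (w, μ) + s (u, H u) (w, μ)
      = mW (L u) w := by
    intro u r w μ
    have h1 := hS u (r, μ)
    have h2 : U u = iW u + iM (H u) := split u (H u)
    rw [hL, h2, split w μ, split u (H u)]
    simp only [c, LinearMap.mk₂_apply] at h1
    simp only [map_add, LinearMap.add_apply]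
    linarith
  refine ⟨Q, H, L, ?_, ?_, ?_⟩
  · intro u w
    -- replacing the test flux `r` by `-r` makes the form symmetric
    rw [← hA u (-Q w) w (H w), ← hA w (-Q u) u (H u)]
    simp only [map_neg, LinearMap.neg_apply]
    rw [mV_symm (Q u), s_symm (u, H u)]
    ring
  · intro u
    rw [← hA u (Q u) u (H u)]
    have h1 := s_nonneg (u, H u)
    have h2 : 0 ≤ mV (Q u) (Q u) := by
      by_cases h : Q u = 0
      · simp [h]
      · exact (mV_pos _ h).le
    linarith
  · intro q u û g
    constructor
    · intro h
      have h1 : (q, û) = (Q u, H u) := by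
        apply injective_of_forall_pos c hc
        refine LinearMap.ext fun y => ?_
        have h2 := h y.1 0 y.2
        rw [hS, split u û, split 0 y.2] at *
        simp only [map_add, map_zero, LinearMap.add_apply, zero_add] at h2
        simp only [c, LinearMap.mk₂_apply]
        linarith
      obtain ⟨rfl, rfl⟩ := Prod.mk.inj h1
      refine ⟨rfl, rfl, ?_⟩
      apply injective_of_forall_pos mW mW_pos
      ext1 w
      rw [← h 0 w 0, hA]
    · rintro ⟨rfl, rfl, rfl⟩ r w μ
      exact hA u r w μ

end Condensation

/-! ### The condensed time step -/

section Reduced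

variable {W : Type*} [AddCommGroup W] [Module ℝ W]

theorem continuous_bilinForm_diag_affine {n : ℕ} (b : LinearMap.BilinForm ℝ W)
    (A : (Fin n → ℝ) →ₗ[ℝ] W) (v : W) : Continuous fun c => b (v + A c) (v + A c) := by
  have h : ∀ c, b (v + A c) (v + A c) = b v v + (b v ∘ₗ A) c + (b.flip v ∘ₗ A) c
      + (b.compl₁₂ A A).toContinuousBilinearMap c c := by
    intro c
    simp only [map_add, LinearMap.add_apply, LinearMap.comp_apply, LinearMap.BilinForm.flip_apply,
      LinearMap.toContinuousBilinearMap_apply, LinearMap.compl₁₂_apply]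
    ring
  simp_rw [h]
  have h1 := (b v ∘ₗ A).continuous_of_finiteDimensional
  have h2 := (b.flip v ∘ₗ A).continuous_of_finiteDimensional
  fun_prop

/-- A positive definite form on `ℝⁿ` is bounded below by a multiple of the squared norm. -/
theorem exists_pos_mul_norm_sq_le {n : ℕ} (b : LinearMap.BilinForm ℝ (Fin n → ℝ))
    (hb : ∀ c, c ≠ 0 → 0 < b c c) : ∃ κ > 0, ∀ c, κ * ‖c‖ ^ 2 ≤ b c c := by
  have hcont : Continuous fun c => b c c := by
    simpa using continuous_bilinForm_diag_affine b LinearMap.id 0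
  rcases (Metric.sphere (0 : Fin n → ℝ) 1).eq_empty_or_nonempty with he | hne
  · refine ⟨1, one_pos, fun c => ?_⟩
    have : c = 0 := by
      by_contra h
      have : ‖c‖⁻¹ • c ∈ Metric.sphere (0 : Fin n → ℝ) 1 := by
        simp [norm_smul, norm_ne_zero_iff.2 h]
      simp [he] at this
    simp [this]
  · obtain ⟨c₀, hc₀, hmin⟩ := (isCompact_sphere (0 : Fin n → ℝ) 1).exists_isMinOn hne
      hcont.continuousOn
    have hn : ‖c₀‖ = 1 := by simpa using hc₀
    refine ⟨b c₀ c₀, hb c₀ (by rintro rfl; simp at hn), fun c => ?_⟩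
    by_cases h : c = 0
    · simp [h]
    have hn' : 0 < ‖c‖ := norm_pos_iff.2 h
    have h1 : ‖c‖⁻¹ • c ∈ Metric.sphere (0 : Fin n → ℝ) 1 := by
      simp [norm_smul, hn'.ne']
    have h2 : b c₀ c₀ ≤ b (‖c‖⁻¹ • c) (‖c‖⁻¹ • c) := hmin h1
    have h3 : b (‖c‖⁻¹ • c) (‖c‖⁻¹ • c) = b c c / ‖c‖ ^ 2 := by
      simp only [map_smul, LinearMap.smul_apply, smul_eq_mul]
      field_simp
    rw [h3, le_div_iff₀ (by positivity)] at h2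
    exact h2

/-- Existence of a solution of the condensed time step
`(u - v) / Δt + L φ = 0`, `∇Φ(u) + ε L u = φ`, where `N u` is the derivative of `Φ` at `u`. With
`u = v - Δt L z`, a minimizer `z` of
`Δt / 2 (L z, z) + Φ(u) + ε / 2 (L u, u)` gives `L z = L φ` for `φ = ∇Φ(u) + ε L u`. The energy is
coercive once `z` is confined to a complement of the kernel of `L`. -/
theorem exists_reduced_solution [FiniteDimensional ℝ W]
    (mW : LinearMap.BilinForm ℝ W) (mW_symm : ∀ u w, mW u w = mW w u)
    (mW_pos : ∀ u, u ≠ 0 → 0 < mW u u) (L : W →ₗ[ℝ] W)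
    (L_symm : ∀ u w, mW (L u) w = mW (L w) u) (L_nonneg : ∀ u, 0 ≤ mW (L u) u)
    (Φ : W → ℝ) (N : W → W →ₗ[ℝ] ℝ) (C₀ : ℝ) (hΦ : ∀ u, C₀ ≤ Φ u)
    (hcont : ∀ (n : ℕ) (A : (Fin n → ℝ) →ₗ[ℝ] W) (v : W), Continuous fun c => Φ (v + A c))
    (hderiv : ∀ u w, HasDerivAt (fun t : ℝ => Φ (u + t • w)) (N u w) 0)
    {ε Δt : ℝ} (hε : 0 < ε) (hΔt : 0 < Δt) (v : W) :
    ∃ u φ, Δt⁻¹ • (u - v) + L φ = 0 ∧ ∀ w, N u w + ε * mW (L u) w - mW φ w = 0 := by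
  -- coordinates on a complement `S` of the kernel of `L`
  obtain ⟨S, hS⟩ := (LinearMap.ker L).exists_isCompl
  let e := (Module.finBasis ℝ S).equivFun
  let A : (Fin (Module.finrank ℝ S) → ℝ) →ₗ[ℝ] W := S.subtype ∘ₗ e.symm.toLinearMap
  let b : LinearMap.BilinForm ℝ W := mW ∘ₗ L
  have hb : ∀ x y, b x y = mW (L x) y := fun _ _ => rfl
  have ker_of_zero : ∀ u, mW (L u) u = 0 → L u = 0 := by
    intro u hu
    by_contra h
    have h1 := LinearMap.BilinForm.apply_sq_le_of_symm b L_nonneg ⟨fun x y => L_symm x y⟩ u (L u)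
    rw [hb, hb, hu, zero_mul] at h1
    have := mW_pos _ h
    nlinarith
  have A_inj : ∀ c, L (A c) = 0 → c = 0 := by
    intro c hc
    have h1 : A c ∈ LinearMap.ker L ⊓ S := ⟨hc, (e.symm c).2⟩
    rw [hS.inf_eq_bot, Submodule.mem_bot] at h1
    have h2 : e.symm c = 0 := Subtype.ext h1
    simpa using h2
  obtain ⟨κ, hκ, hbound⟩ := exists_pos_mul_norm_sq_le
    (b.compl₁₂ A A) (by
      intro c hc
      refine lt_of_le_of_ne (L_nonneg (A c)) fun h => hc (A_inj c (ker_of_zero _ h.symm)))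
  replace hbound : ∀ c, κ * ‖c‖ ^ 2 ≤ b (A c) (A c) := hbound
  -- `v + A' c` is the value of `u` for `z = A c`
  let A' : (Fin (Module.finrank ℝ S) → ℝ) →ₗ[ℝ] W := (-Δt) • (L ∘ₗ A)
  let J : (Fin (Module.finrank ℝ S) → ℝ) → ℝ := fun c =>
    Δt / 2 * b (A c) (A c) + (Φ (v + A' c) + ε / 2 * b (v + A' c) (v + A' c))
  have hJcont : Continuous J := by
    have h1 : Continuous fun c => b (A c) (A c) := by
      simpa using continuous_bilinForm_diag_affine b A 0
    have h2 := continuous_bilinForm_diag_affine b A' v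
    have h3 := hcont _ A' v
    exact (h1.const_mul _).add (h3.add (h2.const_mul _))
  have hJtop : Filter.Tendsto J (Filter.cocompact _) Filter.atTop := by
    have h1 : Filter.Tendsto (fun c : Fin (Module.finrank ℝ S) → ℝ => Δt / 2 * κ * ‖c‖ ^ 2 + C₀)
        (Filter.cocompact _) Filter.atTop :=
      Filter.tendsto_atTop_add_const_right _ _
        (((Filter.tendsto_pow_atTop two_ne_zero).comp
          (tendsto_norm_cocompact_atTop)).const_mul_atTop (by positivity))
    refine Filter.tendsto_atTop_mono (fun c => ?_) h1
    have h2 := mul_le_mul_of_nonneg_left (hbound c) (by positivity : 0 ≤ Δt / 2)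
    have h3 := hΦ (v + A' c)
    have h4 := mul_nonneg (by positivity : 0 ≤ ε / 2) (L_nonneg (v + A' c))
    simp only [J]
    rw [← hb] at h4
    linarith
  obtain ⟨c, hc⟩ := hJcont.exists_forall_le hJtop
  set u := v + A' c with hu
  -- the stationarity of `J` at `c`
  have hstat : ∀ d, mW (L (A c)) (A d) - (N u (L (A d)) + ε * mW (L u) (L (A d))) = 0 := by
    intro d
    have hder : HasDerivAt (fun t : ℝ => J (c + t • d))
        (Δt / 2 * (2 * b (A c) (A d)) + (N u (A' d) + ε / 2 * (2 * b u (A' d)))) 0 := by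
      have hquad : ∀ x y : W, HasDerivAt (fun t : ℝ => b (x + t • y) (x + t • y))
          (2 * b x y) 0 := by
        intro x y
        have h1 : ∀ t : ℝ, b (x + t • y) (x + t • y) = b x x + t * (2 * b x y) + t ^ 2 * b y y := by
          intro t
          have : b y x = b x y := L_symm y x
          simp only [map_add, map_smul, LinearMap.add_apply, LinearMap.smul_apply, smul_eq_mul, this]
          ring
        simp_rw [h1]
        have h2 := (((hasDerivAt_id (0 : ℝ)).mul_const (2 * b x y)).const_add (b x x)).add
          ((hasDerivAt_pow 2 (0 : ℝ)).mul_const (b y y))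
        exact (h2.congr_deriv (by simp))
      have h1 := (hquad (A c) (A d)).const_mul (Δt / 2)
      have h2 := (hderiv u (A' d)).add ((hquad u (A' d)).const_mul (ε / 2))
      refine (h1.add h2).congr_of_eventuallyEq (Filter.Eventually.of_forall fun t => ?_)
      simp only [J, hu, map_add, map_smul, Pi.add_apply, add_assoc]
    have hmin : IsLocalMin (fun t : ℝ => J (c + t • d)) 0 :=
      Filter.Eventually.of_forall fun t => by simpa using hc (c + t • d)
    have h0 := hmin.hasDerivAt_eq_zero hder
    have hA'd : A' d = -(Δt • L (A d)) := by simp [A']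
    rw [hA'd] at h0
    simp only [map_neg, map_smul, smul_eq_mul, hb] at h0
    have : Δt * (mW (L (A c)) (A d) - (N u (L (A d)) + ε * mW (L u) (L (A d)))) = 0 := by
      linarith
    exact (mul_eq_zero.1 this).resolve_left hΔt.ne'
  obtain ⟨φ, hφ⟩ := surjective_of_forall_pos mW mW_pos (N u + ε • mW (L u))
  have hφ' : ∀ w, mW φ w = N u w + ε * mW (L u) w := fun w => by rw [hφ]; rfl
  have hLφ : L (A c) = L φ := by
    apply injective_of_forall_pos mW mW_pos
    ext1 y
    -- only the `S`-component of the test vector `y` contributes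
    obtain ⟨y₁, hy₁, y₂, hy₂, rfl⟩ := Submodule.mem_sup.1
      (hS.sup_eq_top ▸ Submodule.mem_top : y ∈ LinearMap.ker L ⊔ S)
    obtain ⟨d, hd⟩ : ∃ d, A d = y₂ := ⟨e ⟨y₂, hy₂⟩, by simp [A]⟩
    have h1 := hstat d
    rw [← hφ', mW_symm φ, L_symm (A d) φ, hd] at h1
    rw [LinearMap.mem_ker] at hy₁
    rw [L_symm _ (y₁ + y₂), L_symm _ (y₁ + y₂), map_add, hy₁, zero_add, L_symm y₂, L_symm y₂]
    linarith
  refine ⟨u, φ, ?_, fun w => by rw [hφ']; ring⟩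
  rw [← hLφ, hu]
  simp [A', smul_smul, hΔt.ne']

/-- Uniqueness for the condensed time step. For the difference `(u, φ)` of two solutions,
`‖u‖² = -Δt (L φ, u)` and `Δt (L φ, φ) + ε (L u, u) ≤ lam ‖u‖²`, which by the Cauchy–Schwarz
inequality for the form of `L` forces `u = 0`. -/
theorem reduced_solution_unique
    (mW : LinearMap.BilinForm ℝ W) (mW_symm : ∀ u w, mW u w = mW w u)
    (mW_pos : ∀ u, u ≠ 0 → 0 < mW u u) (L : W →ₗ[ℝ] W)
    (L_symm : ∀ u w, mW (L u) w = mW (L w) u) (L_nonneg : ∀ u, 0 ≤ mW (L u) u)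
    (N : W → W →ₗ[ℝ] ℝ) {ε Δt lam : ℝ} (hε : 0 < ε) (hΔt : 0 < Δt)
    (hN : ∀ u₁ u₂, -(lam * mW (u₁ - u₂) (u₁ - u₂)) ≤ N u₁ (u₁ - u₂) - N u₂ (u₁ - u₂))
    (hlam : lam ^ 2 * Δt < 4 * ε) (v : W) {u₁ φ₁ u₂ φ₂ : W}
    (h₁ : Δt⁻¹ • (u₁ - v) + L φ₁ = 0) (h₁' : ∀ w, N u₁ w + ε * mW (L u₁) w - mW φ₁ w = 0)
    (h₂ : Δt⁻¹ • (u₂ - v) + L φ₂ = 0) (h₂' : ∀ w, N u₂ w + ε * mW (L u₂) w - mW φ₂ w = 0) :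
    u₁ = u₂ ∧ φ₁ = φ₂ := by
  have hu : u₁ = u₂ := by
    rw [← sub_eq_zero]
    by_contra hne
    set u := u₁ - u₂ with hu
    set φ := φ₁ - φ₂ with hφ
    have e1 : u = -(Δt • L φ) := by
      have h3 : Δt⁻¹ • u + L φ = 0 := by
        have := congrArg₂ (· - ·) h₁ h₂
        simp only [sub_zero] at this
        rw [← this, hu, hφ, map_sub, ← sub_sub_sub_cancel_right u₁ u₂ v, smul_sub]
        abel
      have h4 : Δt • (Δt⁻¹ • u + L φ) = 0 := by rw [h3, smul_zero]
      rw [smul_add, smul_inv_smul₀ hΔt.ne'] at h4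
      exact eq_neg_of_add_eq_zero_left h4
    have e2 : mW φ u = N u₁ u - N u₂ u + ε * mW (L u) u := by
      have h3 := h₁' u
      have h4 := h₂' u
      have h5 : mW φ u = mW φ₁ u - mW φ₂ u := by rw [hφ]; simp
      have h6 : mW (L u) u = mW (L u₁) u - mW (L u₂) u := by
        conv_lhs => rw [show L u = L u₁ - L u₂ by rw [hu, map_sub]]
        simp
      rw [h5, h6]; linarith
    have e3 : mW φ u = -(Δt * mW (L φ) φ) := by
      conv_lhs => rw [e1]
      rw [map_neg, map_smul, smul_eq_mul, mW_symm φ]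
    have e4 : mW u u = -(Δt * mW (L φ) u) := by
      conv_lhs => enter [1]; rw [e1]
      simp
    have hpos := mW_pos u hne
    have hcs := LinearMap.BilinForm.apply_sq_le_of_symm (mW ∘ₗ L) L_nonneg
      ⟨fun x y => L_symm x y⟩ φ u
    simp only [LinearMap.comp_apply] at hcs
    have hn := hN u₁ u₂
    rw [← hu] at hn
    have ha := L_nonneg φ
    have hb := L_nonneg u
    generalize mW (L φ) φ = a at *
    generalize mW (L u) u = b at *
    generalize mW (L φ) u = c at *
    generalize mW u u = X at *
    -- `Δt a + ε b ≤ λ X`, `X = -Δt c` and `c² ≤ a b`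
    have k1 : Δt * a + ε * b ≤ lam * X := by linarith
    have k0 : 0 ≤ Δt * a + ε * b := by positivity
    have k2 : (Δt * a + ε * b) ^ 2 ≤ (lam * X) ^ 2 := by gcongr
    have k3 : X ^ 2 ≤ Δt ^ 2 * (a * b) := by
      rw [e4]; nlinarith [sq_nonneg Δt]
    have k4 : 4 * (Δt * ε) * (a * b) ≤ lam ^ 2 * X ^ 2 := by
      nlinarith [sq_nonneg (Δt * a - ε * b)]
    have k5 : 4 * ε * X ^ 2 ≤ lam ^ 2 * Δt * X ^ 2 := by
      have := mul_le_mul_of_nonneg_left k3 (by positivity : 0 ≤ 4 * ε)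
      nlinarith
    have : 0 < X ^ 2 := by positivity
    nlinarith
  refine ⟨hu, injective_of_forall_pos mW mW_pos ?_⟩
  ext1 w
  have h3 := h₁' w
  have h4 := h₂' w
  rw [hu] at h3
  linarith

end Reduced

/-! ### Polynomials on an element -/

section Polynomials

variable {d : ℕ} {Ω : Set (EuclideanSpace ℝ (Fin d))} {T : Triangulation Ω}

@[simp] theorem evalAt_add (p q : MvPolynomial (Fin d) ℝ) (x : EuclideanSpace ℝ (Fin d)) :
    evalAt (p + q) x = evalAt p x + evalAt q x := map_add _ _ _

@[simp] theorem evalAt_sub (p q : MvPolynomial (Fin d) ℝ) (x : EuclideanSpace ℝ (Fin d)) :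
    evalAt (p - q) x = evalAt p x - evalAt q x := map_sub _ _ _

@[simp] theorem evalAt_mul (p q : MvPolynomial (Fin d) ℝ) (x : EuclideanSpace ℝ (Fin d)) :
    evalAt (p * q) x = evalAt p x * evalAt q x := map_mul _ _ _

@[simp] theorem evalAt_pow (p : MvPolynomial (Fin d) ℝ) (n : ℕ) (x : EuclideanSpace ℝ (Fin d)) :
    evalAt (p ^ n) x = evalAt p x ^ n := map_pow _ _ _

@[simp] theorem evalAt_smul (c : ℝ) (p : MvPolynomial (Fin d) ℝ) (x : EuclideanSpace ℝ (Fin d)) :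
    evalAt (c • p) x = c * evalAt p x := by
  simp [evalAt]

@[simp] theorem evalAt_sum {ι : Type*} (s : Finset ι) (p : ι → MvPolynomial (Fin d) ℝ)
    (x : EuclideanSpace ℝ (Fin d)) : evalAt (∑ i ∈ s, p i) x = ∑ i ∈ s, evalAt (p i) x :=
  map_sum _ _ _

theorem isCompact_carrier (K : T.Elem) : IsCompact K.carrier :=
  K.1.finite_toSet.isCompact_convexHull ℝ

theorem interior_carrier_nonempty (K : T.Elem) : (interior K.carrier).Nonempty := by
  have h1 := T.cplx.indep K.2.1
  have h2 := h1.affineSpan_eq_top_iff_card_eq_finrank_add_one.2 (by simpa using K.2.2)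
  refine interior_convexHull_nonempty_iff_affineSpan_eq_top.2 ?_
  simpa using h2

theorem integrableOn_evalAt (K : T.Elem) (p : MvPolynomial (Fin d) ℝ) :
    IntegrableOn (evalAt p) K.carrier :=
  (continuous_evalAt p).continuousOn.integrableOn_compact (isCompact_carrier K)

/-- A polynomial that vanishes on a nonempty open set is zero. -/
theorem eq_zero_of_eqOn_isOpen {U : Set (EuclideanSpace ℝ (Fin d))} (hU : IsOpen U)
    (hne : U.Nonempty) {p : MvPolynomial (Fin d) ℝ} (hp : ∀ x ∈ U, evalAt p x = 0) : p = 0 := by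
  obtain ⟨x₀, hx₀⟩ := hne
  have hV : IsOpen ((WithLp.toLp 2 : (Fin d → ℝ) → EuclideanSpace ℝ (Fin d)) ⁻¹' U) :=
    hU.preimage (PiLp.continuous_toLp 2 _)
  obtain ⟨δ, hδ, hball⟩ := Metric.isOpen_iff.1 hV (WithLp.ofLp x₀) (by simpa using hx₀)
  refine MvPolynomial.funext_set (fun i => Metric.ball (x₀ i) δ) (fun i => ?_) fun y hy => ?_
  · rw [Real.ball_eq_Ioo]
    exact Set.Ioo_infinite (by linarith)
  · have h1 : y ∈ Metric.ball (WithLp.ofLp x₀) δ := by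
      rw [ball_pi _ hδ]
      exact hy
    simpa [evalAt] using hp _ (hball h1)

/-- Integration of polynomials over the element `K`. -/
def elemIntegral (K : T.Elem) : MvPolynomial (Fin d) ℝ →ₗ[ℝ] ℝ where
  toFun p := ∫ x in K.carrier, evalAt p x
  map_add' p q := by
    simp only [evalAt_add]
    exact integral_add (integrableOn_evalAt K p) (integrableOn_evalAt K q)
  map_smul' c p := by
    simp only [evalAt_smul, RingHom.id_apply, smul_eq_mul]
    exact integral_const_mul _ _

theorem elemIntegral_apply (K : T.Elem) (p : MvPolynomial (Fin d) ℝ) :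
    elemIntegral K p = ∫ x in K.carrier, evalAt p x := rfl

theorem elemIntegral_nonneg (K : T.Elem) {p : MvPolynomial (Fin d) ℝ} (hp : ∀ x, 0 ≤ evalAt p x) :
    0 ≤ elemIntegral K p :=
  integral_nonneg hp

/-- The `L²(K)` inner product of polynomials. -/
def elemForm (K : T.Elem) : LinearMap.BilinForm ℝ (MvPolynomial (Fin d) ℝ) :=
  (LinearMap.mul ℝ (MvPolynomial (Fin d) ℝ)).compr₂ (elemIntegral K)

theorem elemForm_apply (K : T.Elem) (p q : MvPolynomial (Fin d) ℝ) :
    elemForm K p q = elemIntegral K (p * q) := rfl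

theorem elemForm_symm (K : T.Elem) (p q : MvPolynomial (Fin d) ℝ) :
    elemForm K p q = elemForm K q p := by
  rw [elemForm_apply, elemForm_apply, mul_comm]

theorem elemForm_self_nonneg (K : T.Elem) (p : MvPolynomial (Fin d) ℝ) : 0 ≤ elemForm K p p :=
  elemIntegral_nonneg K fun x => by simpa using mul_self_nonneg _

theorem elemForm_self_pos (K : T.Elem) {p : MvPolynomial (Fin d) ℝ} (hp : p ≠ 0) :
    0 < elemForm K p p := by
  refine lt_of_le_of_ne (elemForm_self_nonneg K p) fun h => hp ?_
  have h1 := (setIntegral_eq_zero_iff_of_nonneg_ae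
    (Filter.Eventually.of_forall fun x => by simpa using mul_self_nonneg _)
    (integrableOn_evalAt K (p * p))).1 h.symm
  have h2 := ae_restrict_of_ae_restrict_of_subset interior_subset h1
  have h3 := Measure.eqOn_open_of_ae_eq (f := evalAt (p * p)) (g := 0) h2 isOpen_interior
    (continuous_evalAt _).continuousOn continuous_zero.continuousOn
  refine eq_zero_of_eqOn_isOpen isOpen_interior (interior_carrier_nonempty K) fun x hx => ?_
  simpa using h3 hx

end Polynomials

/-! ### The bilinear forms of the scheme -/

section Forms

variable {d : ℕ} {Ω : Set (EuclideanSpace ℝ (Fin d))} {T : Triangulation Ω} {k m : ℕ}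

/-- Restriction of a piecewise polynomial to `K`. -/
def onElem (m : ℕ) (K : T.Elem) : T.BrokenPoly m →ₗ[ℝ] MvPolynomial (Fin d) ℝ :=
  (MvPolynomial.restrictTotalDegree (Fin d) ℝ m).subtype ∘ₗ LinearMap.proj K

/-- The `i`-th component of a flux on `K`. -/
def fluxComponent (k : ℕ) (K : T.Elem) (i : Fin d) :
    T.FluxSpace k →ₗ[ℝ] MvPolynomial (Fin d) ℝ :=
  (MvPolynomial.restrictTotalDegree (Fin d) ℝ k).subtype ∘ₗ LinearMap.proj i ∘ₗ LinearMap.proj K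

/-- The divergence on `K`, as a linear map. -/
def divMap (k : ℕ) (K : T.Elem) : T.FluxSpace k →ₗ[ℝ] MvPolynomial (Fin d) ℝ :=
  ∑ i, (MvPolynomial.pderiv i).toLinearMap ∘ₗ fluxComponent k K i

/-- The normal trace on the face `E` of `K`, as a linear map. -/
def normalTraceMap (k : ℕ) (K : T.Elem) (E : T.Face) :
    T.FluxSpace k →ₗ[ℝ] Triangulation.L2 E :=
  ∑ i, Triangulation.normal K E i • (Triangulation.trace E ∘ₗ fluxComponent k K i)

/-- The value of a numerical trace on the face `E`, in `L²(E)`. -/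
def onFace (k : ℕ) (E : T.Face) : T.TraceSpace k →ₗ[ℝ] Triangulation.L2 E :=
  (Triangulation.facePoly k E).subtype ∘ₗ LinearMap.proj E

/-- The stabilization jump `Π w - μ` on the face `E` of `K`, as a linear map of `(w, μ)`. -/
def stabJumpMap (k m : ℕ) (K : T.Elem) (E : T.Face) :
    T.BrokenPoly m × T.TraceSpace k →ₗ[ℝ] Triangulation.L2 E :=
  ((Triangulation.facePoly k E).starProjection.toLinearMap ∘ₗ Triangulation.trace E ∘ₗ
      onElem m K) ∘ₗ LinearMap.fst ℝ _ _ - onFace k E ∘ₗ LinearMap.snd ℝ _ _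

variable (T)

/-- The inner product of `W_h`. -/
def scalarForm (m : ℕ) : LinearMap.BilinForm ℝ (T.BrokenPoly m) :=
  ∑ K, (elemForm K).compl₁₂ (onElem m K) (onElem m K)

/-- The inner product of `V_h`. -/
def fluxForm (k : ℕ) : LinearMap.BilinForm ℝ (T.FluxSpace k) :=
  ∑ K, ∑ i, (elemForm K).compl₁₂ (fluxComponent k K i) (fluxComponent k K i)

/-- The coupling `(u, ∇·r) - ⟨û, r·n⟩` of a flux `r` and a pair `(u, û)`. -/
def couplingForm (k m : ℕ) :
    T.FluxSpace k →ₗ[ℝ] T.BrokenPoly m × T.TraceSpace k →ₗ[ℝ] ℝ :=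
  ∑ K, (elemForm K).compl₁₂ (divMap k K) (onElem m K ∘ₗ LinearMap.fst ℝ _ _)
    - ∑ K : T.Elem, ∑ E ∈ K.bdry, (innerₗ (Triangulation.L2 E)).compl₁₂ (normalTraceMap k K E)
        (onFace k E ∘ₗ LinearMap.snd ℝ _ _)

/-- The stabilization `⟨h_K⁻¹(Π u - û), Π w - μ⟩`. -/
def stabForm (k m : ℕ) : LinearMap.BilinForm ℝ (T.BrokenPoly m × T.TraceSpace k) :=
  ∑ K : T.Elem, ∑ E ∈ K.bdry, K.diam⁻¹ • (innerₗ (Triangulation.L2 E)).compl₁₂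
    (stabJumpMap k m K E) (stabJumpMap k m K E)

variable {T}

theorem scalarForm_apply (u w : T.BrokenPoly m) :
    scalarForm T m u w = ∑ K, elemForm K (u K).1 (w K).1 := by
  simp [scalarForm, LinearMap.sum_apply, onElem]

theorem inner_T_eq (u w : T.Elem → MvPolynomial (Fin d) ℝ) :
    Triangulation.inner_T u w = ∑ K, elemForm K (u K) (w K) := by
  simp [Triangulation.inner_T, elemForm_apply, elemIntegral_apply]

theorem inner_T_on (u w : T.BrokenPoly m) :
    Triangulation.inner_T u.on w.on = scalarForm T m u w := by
  rw [inner_T_eq, scalarForm_apply]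
  rfl

theorem fluxForm_apply (q r : T.FluxSpace k) :
    fluxForm T k q r = ∑ K, ∑ i, elemForm K (q K i).1 (r K i).1 := by
  simp [fluxForm, LinearMap.sum_apply, fluxComponent]

theorem innerFlux_eq (q r : T.FluxSpace k) : Triangulation.innerFlux q r = fluxForm T k q r := by
  rw [fluxForm_apply]
  refine Finset.sum_congr rfl fun K _ => ?_
  simp only [elemForm_apply]
  rw [← map_sum]
  simp only [elemIntegral_apply, evalAt_sum, evalAt_mul]

theorem couplingForm_apply (r : T.FluxSpace k) (u : T.BrokenPoly m) (μ : T.TraceSpace k) :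
    couplingForm T k m r (u, μ) = Triangulation.inner_T r.div u.on
      - Triangulation.inner_bdry (Triangulation.normalTrace r) (Triangulation.twoSided μ) := by
  simp [couplingForm, inner_T_eq, Triangulation.inner_bdry, LinearMap.sum_apply, divMap,
    normalTraceMap, fluxComponent, onElem, onFace, Triangulation.FluxSpace.div,
    Triangulation.normalTrace, Triangulation.twoSided, Triangulation.BrokenPoly.on, sum_inner,
    real_inner_smul_left]

theorem stabJumpMap_apply (K : T.Elem) (E : T.Face) (u : T.BrokenPoly m) (μ : T.TraceSpace k) :
    stabJumpMap k m K E (u, μ) = Triangulation.stabJump u μ K E := rfl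

theorem stabForm_apply (X Y : T.BrokenPoly m × T.TraceSpace k) :
    stabForm T k m X Y = ∑ K : T.Elem, ∑ E ∈ K.bdry, K.diam⁻¹ *
      inner ℝ (stabJumpMap k m K E X) (stabJumpMap k m K E Y) := by
  simp [stabForm, LinearMap.sum_apply]

theorem formA_eq (q : T.FluxSpace k) (u : T.BrokenPoly (k + 1)) (û : T.TraceSpace k)
    (r : T.FluxSpace k) (w : T.BrokenPoly (k + 1)) (μ : T.TraceSpace k) :
    Triangulation.formA q u û r w μ = fluxForm T k q r - couplingForm T k (k + 1) r (u, û)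
      + couplingForm T k (k + 1) q (w, μ) + stabForm T k (k + 1) (u, û) (w, μ) := by
  have h1 : Triangulation.inner_T u.on r.div = Triangulation.inner_T r.div u.on := by
    simp only [inner_T_eq]
    exact Finset.sum_congr rfl fun K _ => elemForm_symm _ _ _
  have h2 : Triangulation.inner_bdry (Triangulation.twoSided û) (Triangulation.normalTrace r)
      = Triangulation.inner_bdry (Triangulation.normalTrace r) (Triangulation.twoSided û) := by
    simp only [Triangulation.inner_bdry]
    exact Finset.sum_congr rfl fun K _ => Finset.sum_congr rfl fun E _ => real_inner_comm _ _
  have h3 : Triangulation.inner_bdry (fun K E => K.diam⁻¹ • Triangulation.stabJump u û K E)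
      (Triangulation.stabJump w μ) = stabForm T k (k + 1) (u, û) (w, μ) := by
    rw [stabForm_apply]
    simp only [Triangulation.inner_bdry, real_inner_smul_left, stabJumpMap_apply]
  rw [Triangulation.formA, innerFlux_eq, h1, h2, h3, couplingForm_apply, couplingForm_apply]
  ring

theorem scalarForm_symm (u w : T.BrokenPoly m) : scalarForm T m u w = scalarForm T m w u := by
  simp only [scalarForm_apply]
  exact Finset.sum_congr rfl fun K _ => elemForm_symm _ _ _

theorem scalarForm_pos (u : T.BrokenPoly m) (hu : u ≠ 0) : 0 < scalarForm T m u u := by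
  obtain ⟨K, hK⟩ := Function.ne_iff.1 hu
  rw [scalarForm_apply]
  exact Finset.sum_pos' (fun K _ => elemForm_self_nonneg K _)
    ⟨K, Finset.mem_univ _, elemForm_self_pos K fun h => hK (Subtype.ext h)⟩

theorem fluxForm_symm (q r : T.FluxSpace k) : fluxForm T k q r = fluxForm T k r q := by
  simp only [fluxForm_apply]
  exact Finset.sum_congr rfl fun K _ => Finset.sum_congr rfl fun i _ => elemForm_symm _ _ _

theorem fluxForm_pos (q : T.FluxSpace k) (hq : q ≠ 0) : 0 < fluxForm T k q q := by
  obtain ⟨K, hK⟩ := Function.ne_iff.1 hq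
  obtain ⟨i, hi⟩ := Function.ne_iff.1 hK
  rw [fluxForm_apply]
  exact Finset.sum_pos' (fun K _ => Finset.sum_nonneg fun i _ => elemForm_self_nonneg K _)
    ⟨K, Finset.mem_univ _, Finset.sum_pos' (fun i _ => elemForm_self_nonneg K _)
      ⟨i, Finset.mem_univ _, elemForm_self_pos K fun h => hi (Subtype.ext h)⟩⟩

theorem stabForm_symm (X Y : T.BrokenPoly m × T.TraceSpace k) :
    stabForm T k m X Y = stabForm T k m Y X := by
  simp only [stabForm_apply]
  exact Finset.sum_congr rfl fun K _ => Finset.sum_congr rfl fun E _ => by rw [real_inner_comm]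

theorem stabForm_self_nonneg (X : T.BrokenPoly m × T.TraceSpace k) : 0 ≤ stabForm T k m X X := by
  rw [stabForm_apply]
  exact Finset.sum_nonneg fun K _ => Finset.sum_nonneg fun E _ =>
    mul_nonneg (inv_nonneg.2 Metric.diam_nonneg) real_inner_self_nonneg

theorem diam_pos (hd : 0 < d) (K : T.Elem) : 0 < K.diam := by
  obtain ⟨x, hx, y, hy, hxy⟩ := Finset.one_lt_card.1 (by rw [K.2.2]; omega : 1 < K.1.card)
  exact (dist_pos.2 hxy).trans_le (Metric.dist_le_diam_of_mem (isCompact_carrier K).isBounded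
    (subset_convexHull ℝ _ hx) (subset_convexHull ℝ _ hy))

/-- The stabilization controls the numerical trace, because each face lies on the boundary of some
element. -/
theorem stabForm_trace_pos (hd : 0 < d) (μ : T.TraceSpace k) (hμ : μ ≠ 0) :
    0 < stabForm T k m (0, μ) (0, μ) := by
  obtain ⟨E, hE⟩ := Function.ne_iff.1 hμ
  obtain ⟨t, ht, hEt, hcard⟩ := T.pure_dim E.1 E.2.1
  have hnonneg : ∀ (K : T.Elem) (E : T.Face), 0 ≤ K.diam⁻¹ *
      inner ℝ (stabJumpMap k m K E (0, μ)) (stabJumpMap k m K E (0, μ)) := fun K E =>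
    mul_nonneg (inv_nonneg.2 Metric.diam_nonneg) real_inner_self_nonneg
  rw [stabForm_apply]
  refine Finset.sum_pos' (fun K _ => Finset.sum_nonneg fun E _ => hnonneg K E)
    ⟨⟨t, ht, hcard⟩, Finset.mem_univ _, Finset.sum_pos' (fun E _ => hnonneg _ E)
      ⟨E, by simpa [Triangulation.Elem.bdry] using hEt, ?_⟩⟩
  refine mul_pos (inv_pos.2 (diam_pos hd _)) (real_inner_self_pos.2 ?_)
  simpa [stabJumpMap, onFace] using hE

end Forms

/-! ### The potential energy -/

section Nonlinearity

variable {d : ℕ} {Ω : Set (EuclideanSpace ℝ (Fin d))} {T : Triangulation Ω} {m : ℕ}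

/-- `u³ - a u - b v`, as a polynomial on an element. -/
def cubicPoly (a b : ℝ) (u v : MvPolynomial (Fin d) ℝ) : MvPolynomial (Fin d) ℝ :=
  u ^ 3 - a • u - b • v

/-- The primitive `u⁴/4 - a u²/2 - b v u` of `u³ - a u - b v` with respect to `u`. -/
def quarticPoly (a b : ℝ) (u v : MvPolynomial (Fin d) ℝ) : MvPolynomial (Fin d) ℝ :=
  (1 / 4 : ℝ) • u ^ 4 - (a / 2) • u ^ 2 - b • (v * u)

/-- The potential energy `ε⁻¹ ∫ (u⁴/4 - a u²/2 - b v u)`. -/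
def potential (a b ε : ℝ) (v u : T.BrokenPoly m) : ℝ :=
  ∑ K, ε⁻¹ * elemIntegral K (quarticPoly a b (u K).1 (v K).1)

/-- The derivative of `potential` at `u`. -/
def potentialDeriv (a b ε : ℝ) (v u : T.BrokenPoly m) : T.BrokenPoly m →ₗ[ℝ] ℝ :=
  ∑ K, ε⁻¹ • (elemForm K (cubicPoly a b (u K).1 (v K).1) ∘ₗ onElem m K)

theorem potentialDeriv_apply (a b ε : ℝ) (v u w : T.BrokenPoly m) :
    potentialDeriv a b ε v u w =
      ∑ K, ε⁻¹ * elemIntegral K (cubicPoly a b (u K).1 (v K).1 * (w K).1) := by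
  simp [potentialDeriv, LinearMap.sum_apply, elemForm_apply, onElem]

theorem exists_le_potential (a b : ℝ) {ε : ℝ} (hε : 0 < ε) (v : T.BrokenPoly m) :
    ∃ C₀, ∀ u, C₀ ≤ potential a b ε v u := by
  refine ⟨∑ K, ε⁻¹ * elemIntegral K
    (MvPolynomial.C (-(a + 1) ^ 2 / 4) - (b ^ 2 / 2) • (v K).1 ^ 2), fun u => ?_⟩
  refine Finset.sum_le_sum fun K _ => mul_le_mul_of_nonneg_left ?_ (by positivity)
  rw [← sub_nonneg, ← map_sub]
  refine elemIntegral_nonneg K fun x => ?_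
  have hC : ∀ c : ℝ, evalAt (MvPolynomial.C c : MvPolynomial (Fin d) ℝ) x = c := fun c => by
    simp [evalAt]
  simp only [quarticPoly, evalAt_sub, evalAt_smul, evalAt_mul, evalAt_pow, hC]
  nlinarith [sq_nonneg (evalAt (u K).1 x ^ 2 - (a + 1)),
    sq_nonneg (evalAt (u K).1 x - b * evalAt (v K).1 x)]

theorem continuous_potential_affine (a b ε : ℝ) (v : T.BrokenPoly m) (n : ℕ)
    (A : (Fin n → ℝ) →ₗ[ℝ] T.BrokenPoly m) (u : T.BrokenPoly m) :
    Continuous fun c => potential a b ε v (u + A c) := by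
  refine continuous_finsetSum _ fun K _ => Continuous.const_mul ?_ _
  refine continuous_parametric_integral_of_continuous ?_ (isCompact_carrier K)
  have h : ∀ c x, evalAt ((u + A c) K).1 x
      = evalAt (u K).1 x + ∑ i, c i * evalAt (A (Pi.single i 1) K).1 x := by
    intro c x
    have h1 : ((A c) K).1 = ∑ i, c i • (A (Pi.single i 1) K).1 := by
      have h2 : c = ∑ i, c i • (Pi.single i 1 : Fin n → ℝ) := by
        ext j
        simp [Finset.sum_apply, Pi.single_apply]
      have h3 := congrArg (onElem m K ∘ₗ A) h2
      rw [map_sum] at h3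
      simpa [onElem] using h3
    simp [h1]
  simp only [Function.uncurry_def, quarticPoly, evalAt_sub, evalAt_smul, evalAt_mul, evalAt_pow, h]
  have h2 : ∀ p : MvPolynomial (Fin d) ℝ,
      Continuous fun y : (Fin n → ℝ) × EuclideanSpace ℝ (Fin d) => evalAt p y.2 := fun p =>
    (continuous_evalAt p).comp continuous_snd
  have h3 := h2 (u K).1
  have h4 := h2 (v K).1
  have h5 := fun i => h2 (A (Pi.single i 1) K).1
  fun_prop

theorem hasDerivAt_potential (a b ε : ℝ) (v u w : T.BrokenPoly m) :
    HasDerivAt (fun t : ℝ => potential a b ε v (u + t • w)) (potentialDeriv a b ε v u w) 0 := by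
  rw [potentialDeriv_apply]
  refine HasDerivAt.fun_sum fun K _ => HasDerivAt.const_mul _ ?_
  set I := elemIntegral K
  set p := (u K).1
  set q := (v K).1
  set r := (w K).1
  -- the Taylor expansion of the quartic
  have h : ∀ t : ℝ, I (quarticPoly a b ((u + t • w) K).1 q) = I (quarticPoly a b p q)
      + t * I (cubicPoly a b p q * r) + t ^ 2 * I ((3 / 2 : ℝ) • (p ^ 2 * r ^ 2) - (a / 2) • r ^ 2)
      + t ^ 3 * I (p * r ^ 3) + t ^ 4 * I ((1 / 4 : ℝ) • r ^ 4) := by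
    intro t
    have h1 : ((u + t • w) K).1 = p + t • r := rfl
    simp only [← smul_eq_mul, ← map_smul, ← map_add, h1]
    congr 1
    simp only [quarticPoly, cubicPoly, MvPolynomial.smul_eq_C_mul, smul_eq_mul]
    have h4 : (MvPolynomial.C (1 / 4) : MvPolynomial (Fin d) ℝ) * 4 = 1 := by
      rw [← map_ofNat MvPolynomial.C 4, ← map_mul]; norm_num
    have h32 : (MvPolynomial.C (3 / 2) : MvPolynomial (Fin d) ℝ) = MvPolynomial.C (1 / 4) * 6 := by
      rw [← map_ofNat MvPolynomial.C 6, ← map_mul]; norm_num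
    have ha : (MvPolynomial.C a : MvPolynomial (Fin d) ℝ) = MvPolynomial.C (a / 2) * 2 := by
      rw [← map_ofNat MvPolynomial.C 2, ← map_mul]; norm_num
    rw [h32, ha, map_pow, map_pow, map_pow]
    linear_combination (MvPolynomial.C t * p ^ 3 * r + (MvPolynomial.C t) ^ 3 * p * r ^ 3) * h4
  simp_rw [h]
  have h1 := ((((hasDerivAt_id (0 : ℝ)).mul_const (I (cubicPoly a b p q * r))).const_add
    (I (quarticPoly a b p q))).add ((hasDerivAt_pow 2 (0 : ℝ)).mul_const
      (I ((3 / 2 : ℝ) • (p ^ 2 * r ^ 2) - (a / 2) • r ^ 2)))).add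
    ((hasDerivAt_pow 3 (0 : ℝ)).mul_const (I (p * r ^ 3)))
  have h2 := h1.add ((hasDerivAt_pow 4 (0 : ℝ)).mul_const (I ((1 / 4 : ℝ) • r ^ 4)))
  exact h2.congr_deriv (by simp)

/-- The cube is monotone, so that only the term `-a u` can violate monotonicity. -/
theorem potentialDeriv_monotone (a b : ℝ) {ε : ℝ} (hε : 0 < ε) (v u₁ u₂ : T.BrokenPoly m) :
    -(a / ε * scalarForm T m (u₁ - u₂) (u₁ - u₂)) ≤
      potentialDeriv a b ε v u₁ (u₁ - u₂) - potentialDeriv a b ε v u₂ (u₁ - u₂) := by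
  rw [potentialDeriv_apply, potentialDeriv_apply, scalarForm_apply, Finset.mul_sum,
    ← Finset.sum_neg_distrib, ← Finset.sum_sub_distrib]
  refine Finset.sum_le_sum fun K _ => ?_
  rw [← mul_sub, ← map_sub, div_eq_inv_mul, mul_assoc, ← mul_neg]
  refine mul_le_mul_of_nonneg_left ?_ (by positivity)
  rw [neg_le_iff_add_nonneg, elemForm_apply, ← smul_eq_mul a, ← map_smul, ← map_add]
  refine elemIntegral_nonneg K fun x => ?_
  have h : evalAt ((u₁ - u₂) K).1 x = evalAt (u₁ K).1 x - evalAt (u₂ K).1 x := evalAt_sub _ _ _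
  simp only [cubicPoly, evalAt_add, evalAt_sub, evalAt_smul, evalAt_mul, evalAt_pow, h]
  generalize evalAt (u₁ K).1 x = y
  generalize evalAt (u₂ K).1 x = z
  have : 0 ≤ (y - z) ^ 2 * ((y + z / 2) ^ 2 + 3 / 4 * z ^ 2) := by positivity
  linarith

end Nonlinearity

/-! ### A single time step -/

section TimeStep

variable {d : ℕ} {Ω : Set (EuclideanSpace ℝ (Fin d))} {T : Triangulation Ω} {k : ℕ}

/-- One step of the scheme with the nonlinearity `u³ - a u - b u_h^{n-1}` has exactly one solution
if `(a / ε)² Δt < 4 ε`. -/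
theorem existsUnique_isStep (hd : 0 < d) {f : ℝ → ℝ → ℝ} {a b : ℝ}
    (hf : ∀ u v, f u v = u ^ 3 - a * u - b * v) {ε Δt : ℝ} (hε : 0 < ε) (hΔt : 0 < Δt)
    (h : (a / ε) ^ 2 * Δt < 4 * ε) (v : T.BrokenPoly (k + 1)) :
    ∃! X : T.Unknowns k, Triangulation.IsStep f ε Δt v X := by
  obtain ⟨Q, H, L, L_symm, L_nonneg, hL⟩ := exists_condensed (fluxForm T k) (scalarForm T (k + 1))
    (couplingForm T k (k + 1)) (stabForm T k (k + 1)) fluxForm_symm fluxForm_pos scalarForm_pos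
    stabForm_symm stabForm_self_nonneg (stabForm_trace_pos hd)
  have hN : ∀ u w : T.BrokenPoly (k + 1), (∑ K : T.Elem, ∫ x in K.carrier,
      ε⁻¹ * f (evalAt (u.on K) x) (evalAt (v.on K) x) * evalAt (w.on K) x)
        = potentialDeriv a b ε v u w := by
    intro u w
    rw [potentialDeriv_apply]
    refine Finset.sum_congr rfl fun K _ => ?_
    rw [elemIntegral_apply, ← integral_const_mul]
    refine integral_congr_ae (Filter.Eventually.of_forall fun x => ?_)
    simp [cubicPoly, hf, Triangulation.BrokenPoly.on, mul_assoc]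
  have hstep : ∀ X : T.Unknowns k, Triangulation.IsStep f ε Δt v X ↔
      (X.p = Q X.φ ∧ X.φhat = H X.φ ∧ X.q = Q X.u ∧ X.uhat = H X.u) ∧
      Δt⁻¹ • (X.u - v) + L X.φ = 0 ∧ ∀ w, potentialDeriv a b ε v X.u w
        + ε * scalarForm T (k + 1) (L X.u) w - scalarForm T (k + 1) X.φ w = 0 := by
    intro X
    have h1 := hL X.p X.φ X.φhat (-(Δt⁻¹ • (X.u - v)))
    obtain ⟨g, hg⟩ := surjective_of_forall_pos (scalarForm T (k + 1)) scalarForm_pos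
      (ε⁻¹ • (scalarForm T (k + 1) X.φ - potentialDeriv a b ε v X.u))
    have hg' : ∀ w, ε * scalarForm T (k + 1) g w
        = scalarForm T (k + 1) X.φ w - potentialDeriv a b ε v X.u w := by
      intro w
      rw [hg]
      simp [hε.ne']
    have h2 := hL X.q X.u X.uhat g
    constructor
    · rintro ⟨e1, e2⟩
      obtain ⟨rp, rφ, r1⟩ := h1.1 fun r w μ => by
        have := e1 r w μ
        rw [inner_T_on, formA_eq] at this
        rw [map_neg, LinearMap.neg_apply]
        linarith
      obtain ⟨rq, ru, r2⟩ := h2.1 fun r w μ => by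
        have := e2 r w μ
        rw [hN, inner_T_on, formA_eq] at this
        have h3 := hg' w
        refine mul_left_cancel₀ hε.ne' ?_
        linarith
      refine ⟨⟨rp, rφ, rq, ru⟩, by rw [← r1]; abel, fun w => ?_⟩
      rw [← r2, hg']
      ring
    · rintro ⟨⟨rp, rφ, rq, ru⟩, r1, r2⟩
      have e1 := h1.2 ⟨rp, rφ, by rw [neg_eq_iff_add_eq_zero]; exact r1⟩
      have e2 := h2.2 ⟨rq, ru, injective_of_forall_pos _ scalarForm_pos (LinearMap.ext fun w => by
        refine mul_left_cancel₀ hε.ne' ?_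
        rw [hg']
        linarith [r2 w])⟩
      refine ⟨fun r w μ => ?_, fun r w μ => ?_⟩
      · have := e1 r w μ
        rw [map_neg, LinearMap.neg_apply] at this
        rw [inner_T_on, formA_eq]
        linarith
      · rw [hN, inner_T_on, formA_eq, e2 r w μ, hg']
        ring
  obtain ⟨C₀, hC₀⟩ := exists_le_potential (T := T) (m := k + 1) a b hε v
  obtain ⟨u, φ, r1, r2⟩ := exists_reduced_solution (scalarForm T (k + 1)) scalarForm_symm
    scalarForm_pos L L_symm L_nonneg (potential a b ε v) (potentialDeriv a b ε v) C₀ hC₀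
    (continuous_potential_affine a b ε v) (hasDerivAt_potential a b ε v) hε hΔt v
  refine ⟨⟨Q φ, φ, H φ, Q u, u, H u⟩, (hstep _).2 ⟨⟨rfl, rfl, rfl, rfl⟩, r1, r2⟩, ?_⟩
  rintro ⟨p', φ', φhat', q', u', uhat'⟩ hX
  obtain ⟨⟨hp, hφ, hq, hu⟩, s1, s2⟩ := (hstep _).1 hX
  dsimp only at hp hφ hq hu s1 s2
  obtain ⟨rfl, rfl⟩ := reduced_solution_unique (scalarForm T (k + 1)) scalarForm_symm
    scalarForm_pos L L_symm L_nonneg (potentialDeriv a b ε v) hε hΔt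
    (potentialDeriv_monotone a b hε v) h v s1 s2 r1 r2
  rw [hp, hφ, hq, hu]

end TimeStep

/-! ### The whole scheme -/

section Scheme

variable {d : ℕ} {Ω : Set (EuclideanSpace ℝ (Fin d))} {T : Triangulation Ω} {k : ℕ}

/-- An `L²(Ω)` function is square integrable on each closed element: the part of the element
outside `Ω` lies in the boundary of the element and is therefore a null set. -/
theorem memLp_carrier (hΩ : interior (closure Ω) = Ω) {u0 : EuclideanSpace ℝ (Fin d) → ℝ}
    (hu0 : MemLp u0 2 (volume.restrict Ω)) (K : T.Elem) :
    MemLp u0 2 (volume.restrict K.carrier) := by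
  have hsub : interior K.carrier ⊆ Ω := by
    conv_rhs => rw [← hΩ, ← T.space_eq]
    exact interior_mono (T.cplx.convexHull_subset_space K.2.1)
  have hnull : volume (frontier K.carrier) = 0 :=
    (convex_convexHull ℝ _).addHaar_frontier volume
  rw [← Measure.restrict_congr_set (interior_ae_eq_of_null_frontier hnull)]
  exact hu0.mono_measure (Measure.restrict_mono hsub le_rfl)

/-- The `L²` projection of the initial datum exists and is unique. -/
theorem existsUnique_initial (m : ℕ) (hΩ : interior (closure Ω) = Ω)
    {u0 : EuclideanSpace ℝ (Fin d) → ℝ} (hu0 : MemLp u0 2 (volume.restrict Ω)) :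
    ∃! uh0 : T.BrokenPoly m, ∀ w : T.BrokenPoly m, Triangulation.inner_T uh0.on w.on
      - ∑ K : T.Elem, ∫ x in K.carrier, u0 x * evalAt (w.on K) x = 0 := by
  have hint : ∀ (K : T.Elem) (p : MvPolynomial (Fin d) ℝ),
      Integrable (fun x => u0 x * evalAt p x) (volume.restrict K.carrier) := by
    intro K p
    have h1 : MemLp (evalAt p) 2 (volume.restrict K.carrier) := by
      rw [memLp_two_iff_integrable_sq (continuous_evalAt p).aestronglyMeasurable]
      simp_rw [← evalAt_pow]
      exact integrableOn_evalAt K (p ^ 2)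
    exact (memLp_carrier hΩ hu0 K).integrable_mul h1
  let ℓ : T.BrokenPoly m →ₗ[ℝ] ℝ :=
    { toFun := fun w => ∑ K : T.Elem, ∫ x in K.carrier, u0 x * evalAt (w.on K) x
      map_add' := fun w w' => by
        rw [← Finset.sum_add_distrib]
        refine Finset.sum_congr rfl fun K _ => ?_
        rw [← integral_add (hint K _) (hint K _)]
        refine integral_congr_ae (Filter.Eventually.of_forall fun x => ?_)
        simp [Triangulation.BrokenPoly.on, mul_add]
      map_smul' := fun c w => by
        rw [RingHom.id_apply, smul_eq_mul, Finset.mul_sum]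
        refine Finset.sum_congr rfl fun K _ => ?_
        rw [← integral_const_mul]
        refine integral_congr_ae (Filter.Eventually.of_forall fun x => ?_)
        simp [Triangulation.BrokenPoly.on, mul_left_comm] }
  have hℓ : ∀ uh0 : T.BrokenPoly m, (∀ w : T.BrokenPoly m, Triangulation.inner_T uh0.on w.on
      - ∑ K : T.Elem, ∫ x in K.carrier, u0 x * evalAt (w.on K) x = 0) ↔
      scalarForm T m uh0 = ℓ := by
    intro uh0
    rw [LinearMap.ext_iff]
    refine forall_congr' fun w => ?_
    rw [inner_T_on, sub_eq_zero]
    rfl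
  obtain ⟨uh0, h⟩ := surjective_of_forall_pos (scalarForm T m) scalarForm_pos ℓ
  refine ⟨uh0, (hℓ _).2 h, fun y hy => injective_of_forall_pos _ scalarForm_pos ?_⟩
  rw [h, (hℓ y).1 hy]

/-- If each single step is uniquely solvable, then so is the whole scheme. -/
theorem uniquelySolvable_of_existsUnique_isStep (hΩ : interior (closure Ω) = Ω)
    {f : ℝ → ℝ → ℝ} {ε Δt : ℝ} (h : ∀ v : T.BrokenPoly (k + 1),
      ∃! X : T.Unknowns k, Triangulation.IsStep f ε Δt v X) : UniquelySolvable T k f ε Δt := by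
  refine ⟨h, fun N u0 hu0 => ?_⟩
  obtain ⟨uh0, h0, h0_unique⟩ := existsUnique_initial (T := T) (k + 1) hΩ hu0
  choose g hg hg_unique using h
  -- the iterates `u_h^n`
  let it : ℕ → T.BrokenPoly (k + 1) := fun n => Nat.rec uh0 (fun _ v => (g v).u) n
  refine ⟨(uh0, fun n => g (it n)), ⟨h0, fun n => ?_⟩, ?_⟩
  · convert hg (it n)
    obtain ⟨n, hn⟩ := n
    cases n <;> rfl
  · rintro ⟨y, X⟩ ⟨hy, hX⟩
    dsimp only at hy hX
    obtain rfl := h0_unique y hy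
    have key : ∀ i (hi : i < N + 1),
        (Fin.cons (α := fun _ => T.BrokenPoly (k + 1)) y (fun m => (X m).u) ⟨i, hi⟩) = it i := by
      intro i
      induction i with
      | zero => intro _; rfl
      | succ i ih =>
        intro hi
        have h1 := hg_unique _ _ (hX ⟨i, by omega⟩)
        have h2 := ih (by omega)
        change (X ⟨i, _⟩).u = (g (it i)).u
        rw [h1, ← h2]
        rfl
    refine Prod.ext rfl (funext fun n => ?_)
    change X n = g (it n)
    rw [← key n (by omega)]
    exact hg_unique _ _ (hX n)

end Scheme

end CahnHilliardHDG
end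

theorem mainTheorem6 (d : ℕ) (hd : d = 2 ∨ d = 3) (k : ℕ) :
    (∀ (Ω : Set (EuclideanSpace ℝ (Fin d))), CahnHilliardHDG.IsRegularDomain Ω →
      ∀ (T : CahnHilliardHDG.Triangulation Ω) (ε Δt : ℝ), 0 < ε → 0 < Δt →
        CahnHilliardHDG.UniquelySolvable T k CahnHilliardHDG.convexSplitting ε Δt) ∧
    (∀ σ : ℝ, ∃ C : ℝ, 0 < C ∧
      ∀ (Ω : Set (EuclideanSpace ℝ (Fin d))), CahnHilliardHDG.IsRegularDomain Ω →
      ∀ (T : CahnHilliardHDG.Triangulation Ω), T.ShapeRegular σ →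
      ∀ (ε Δt : ℝ), 0 < ε → 0 < Δt → Δt ≤ C * ε ^ 3 →
        CahnHilliardHDG.UniquelySolvable T k CahnHilliardHDG.backwardEuler ε Δt) := by
  have hd' : 0 < d := by omega
  refine ⟨fun Ω hΩ T ε Δt hε hΔt => ?_, fun σ => ⟨1, one_pos, fun Ω hΩ T _ ε Δt hε hΔt hle => ?_⟩⟩
  · refine CahnHilliardHDG.uniquelySolvable_of_existsUnique_isStep hΩ.interior_closure fun v =>
      CahnHilliardHDG.existsUnique_isStep hd' (a := 0) (b := 1) ?_ hε hΔt ?_ v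
    · intro u v
      simp [CahnHilliardHDG.convexSplitting]
    · simpa using hε
  · refine CahnHilliardHDG.uniquelySolvable_of_existsUnique_isStep hΩ.interior_closure fun v =>
      CahnHilliardHDG.existsUnique_isStep hd' (a := 1) (b := 0) ?_ hε hΔt ?_ v
    · intro u v
      simp [CahnHilliardHDG.backwardEuler]
    · -- here `(1 / ε)² Δt ≤ ε < 4 ε`
      rw [one_div, inv_pow, inv_mul_lt_iff₀ (by positivity)]
      nlinarith [pow_pos hε 3]
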